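/- Let $\overline\alpha=0.583$ and $c_6=\frac{5}{18\sqrt3}$. For $\delta>0$ put $$V_\delta=\Big(\frac{c_6}{\delta(1-\overline\alpha)}\Big)^{\frac1{2-\overline\alpha}},\qquad Q_\delta=V_\delta^{1/2}\,[-\tfrac12,\tfrac12]^2\subset\mathbb R^2 .$$ Let $\mathcal A_\delta$ be the set of discrete measures $\mu=\sum_{i=1}^{N}m_i\delta_{z_i}$ with $N\in\mathbb N$, $m_i>0$, $\sum_i m_i=V_\delta$, and distinct points $z_i\in Q_\delta$. For $\mu\in\mathcal A_\delta$ let $$\mathcal F_\delta(\mu)=\frac{c_6}{1-\overline\alpha}\sum_{i=1}^{N}m_i^{\overline\alpha}+W_2^2(\mathbb 1_{Q_\delta},\mu),\qquad W_2^2(\mathbb 1_{Q_\delta},\mu)=\inf_T\int_{Q_\delta}|x-T(x)|^2\,dx,$$ where the infimum is over all Borel maps $T:Q_\delta\to\{z_1,\dots,z_N\}$ with $|T^{-1}(z_i)|=m_i$ for all $i$. There is $\delta_0>0$ such that for all $\delta\in(0,\delta_0)$ and every minimizer $\mu=\sum_{i=1}^{N}m_i\delta_{z_i}$ of $\mathcal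 F_\delta$ over $\mathcal A_\delta$ the following hold. (i) If $\mathrm{dist}(z_i,\partial Q_\delta)\ge 4$, then $m_i>\overline m:=2.0620\times10^{-4}$. (ii) If $\mathrm{dist}(z_i,\partial Q_\delta)<4$, then $m_i>m_{\mathrm b}:=1.5212\times10^{-5}$. (iii) If $B\subset Q_\delta$ is an open ball of radius $R$ that contains none of the points $z_i$, then $R<R_0:=3.3644$. (iv) The infimum defining $W_2^2(\mathbb 1_{Q_\delta},\mu)$ is attained, and every optimal map can be modified on a null set so that, for some weights $w_1,\dots,w_N\in\mathbb R$ and all $i$, $$\overline{T^{-1}(z_i)}=\{x\in Q_\delta:\ |x-z_i|^2-w_i\le|x-z_j|^2-w_j\ \text{for all }j\}.$$ For every optimal map $T$ normalized in this way and every $i$, $$\mathrm{diam}\big(T^{-1}(z_i)\big)\le D_0:=2\Big(8R_0^2+\frac{\overline\alpha}{1-\overline\alpha}\,c_6\,m_{\mathrm b}^{\overline\alpha-1}\Big)^{1/2}.$$ -/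

import Mathlib

open MeasureTheory
open scoped ENNReal Pointwise

noncomputable section

namespace Quantization

/-- The Euclidean plane. -/
abbrev Plane : Type := EuclideanSpace ℝ (Fin 2)

/-- The second moment about its centre of a regular hexagon of unit area. -/
def c6 : ℝ := 5 / (18 * √3)

/-- The exponent `0.583`. -/
def alphaBar : ℝ := 0.583

/-- The area of the rescaled square. -/
def vol (δ α : ℝ) : ℝ := (c6 / (δ * (1 - α))) ^ (1 / (2 - α))

/-- The closed unit square `[-1/2, 1/2]²`. -/
def unitSquare : Set Plane := {x | ∀ k, x k ∈ Set.Icc (-(1 / 2) : ℝ) (1 / 2)}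

/-- The rescaled square, of side length `V^{1/2}` with `V = vol δ α`. -/
def square (δ α : ℝ) : Set Plane := (vol δ α ^ (1 / 2 : ℝ)) • unitSquare

/-- An admissible discrete measure `∑ i, m i • δ_{z i}`: finitely many distinct atoms in the
rescaled square, with positive masses that add up to its area. Its support is `Set.range z`. -/
structure Admissible (δ α : ℝ) where
  N : ℕ
  m : Fin N → ℝ
  z : Fin N → Plane
  m_pos : ∀ i, 0 < m i
  sum_m : ∑ i, m i = vol δ α
  z_mem : ∀ i, z i ∈ square δ α
  z_inj : Function.Injective z

namespace Admissible

variable {δ α : ℝ}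

/-- The support of the measure. -/
def supp (μ : Admissible δ α) : Set Plane := Set.range μ.z

/-- The cell `T⁻¹(z i)` of a map `T`, regarded as a map on the rescaled square. -/
def cell (μ : Admissible δ α) (T : Plane → Plane) (i : Fin μ.N) : Set Plane :=
  {x ∈ square δ α | T x = μ.z i}

/-- `T` is a Borel map from the rescaled square to the atoms of `μ` which transports the Lebesgue
measure on the square to `μ`. The values of `T` outside the square play no role. -/
def IsTransportMap (μ : Admissible δ α) (T : Plane → Plane) : Prop :=
  Measurable T ∧ (∀ x ∈ square δ α, T x ∈ μ.supp) ∧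
    ∀ i, volume (μ.cell T i) = ENNReal.ofReal (μ.m i)

/-- The quadratic transport cost of `T` on the rescaled square. -/
def cost (δ α : ℝ) (T : Plane → Plane) : ℝ≥0∞ :=
  ∫⁻ x in square δ α, ENNReal.ofReal (‖x - T x‖ ^ 2)

/-- The squared Wasserstein distance from the Lebesgue measure on the rescaled square to `μ`. -/
def W2sq (μ : Admissible δ α) : ℝ≥0∞ :=
  ⨅ (T : Plane → Plane) (_ : μ.IsTransportMap T), cost δ α T

/-- The rescaled penalized energy. -/
def energy (μ : Admissible δ α) : ℝ≥0∞ :=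
  ENNReal.ofReal (c6 / (1 - α) * ∑ i, μ.m i ^ α) + μ.W2sq

/-- `μ` minimizes the rescaled penalized energy among all admissible measures. -/
def IsMinimizer (μ : Admissible δ α) : Prop :=
  ∀ ν : Admissible δ α, μ.energy ≤ ν.energy

/-- `T` attains the infimum that defines the Wasserstein distance. -/
def IsOptimalMap (μ : Admissible δ α) (T : Plane → Plane) : Prop :=
  μ.IsTransportMap T ∧ cost δ α T = μ.W2sq

/-- The Laguerre (power) cell of the `i`-th atom for the weights `w`. -/
def laguerreCell (μ : Admissible δ α) (w : Fin μ.N → ℝ) (i : Fin μ.N) : Set Plane :=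
  {x ∈ square δ α | ∀ j, ‖x - μ.z i‖ ^ 2 - w i ≤ ‖x - μ.z j‖ ^ 2 - w j}

/-- `T` is an optimal map normalized on a null set so that the closures of its cells are Laguerre
cells. (An optimal map is only determined up to null sets, and the diameter of a cell is not
invariant under changes on null sets.) -/
def IsLaguerreMap (μ : Admissible δ α) (T : Plane → Plane) : Prop :=
  μ.IsOptimalMap T ∧ ∃ w : Fin μ.N → ℝ, ∀ i, closure (μ.cell T i) = μ.laguerreCell w i

end Admissible

/-- The mass bound for cells whose particle is far from the boundary. -/
def mBar : ℝ := 2.0620 / 10 ^ 4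

/-- The mass bound for cells whose particle is close to the boundary. -/
def mB : ℝ := 1.5212 / 10 ^ 5

/-- The bound for the radius of particle-free balls. -/
def R0 : ℝ := 3.3644

/-- The bound for the diameter of the cells. -/
def D0 : ℝ :=
  2 * (8 * R0 ^ 2 + alphaBar / (1 - alphaBar) * c6 * mB ^ (alphaBar - 1)) ^ (1 / 2 : ℝ)

end Quantization

end

open Quantization

/-
The tangent of the concave function `t ↦ t ^ α` at the masses of a minimizer turns the penalty into
the linear form with coefficients `-w i`, where `w` are the weights `weight`, and duality bounds the
transport cost from below by the integral of the smallest of the functions `‖x - z i‖ ^ 2 - w i`,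
plus `∑ i, w i * m i`. Hence the Laguerre cells for `w` have at most the energy of `μ`; strict
concavity makes their areas equal to the masses, and every optimal map has these cells up to null
sets.

Putting a new atom at the centre of a large ball without atoms, fed by a smaller concentric disc,
would lower the energy, so no such ball exists. Merging two cells lowers the penalty by at least
`c6 * m ^ α`, with `m` the smaller mass, and, atoms being barycentres, costs only `m` times the
squared distance of the atoms; so an atom near to another one cannot be light. As the weights are
controlled by the masses, comparing a point of a cell with an atom near to it bounds the diameter.
-/

namespace Quantization

theorem rpow_lt_tangent {a b α : ℝ} (ha : 0 < a) (hb : 0 ≤ b) (hab : b ≠ a) (h0 : 0 < α)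
    (h1 : α < 1) : b ^ α < a ^ α + α * a ^ (α - 1) * (b - a) := by
  have hs : -1 ≤ (b - a) / a := by rw [le_div_iff₀ ha]; linarith
  calc b ^ α = a ^ α * (1 + (b - a) / a) ^ α := by
        rw [← Real.mul_rpow ha.le (by linarith)]; congr 1; field_simp; ring
    _ < a ^ α * (1 + α * ((b - a) / a)) := by
        gcongr
        exact rpow_one_add_lt_one_add_mul_self hs (div_ne_zero (sub_ne_zero.2 hab) ha.ne') h0 h1
    _ = a ^ α + α * a ^ (α - 1) * (b - a) := by rw [Real.rpow_sub_one ha.ne']; ring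

theorem rpow_le_tangent {a b α : ℝ} (ha : 0 < a) (hb : 0 ≤ b) (h0 : 0 < α) (h1 : α < 1) :
    b ^ α ≤ a ^ α + α * a ^ (α - 1) * (b - a) := by
  rcases eq_or_ne b a with rfl | hab
  · simp
  · exact (rpow_lt_tangent ha hb hab h0 h1).le

theorem eq_of_sum_tangent_le_sum_rpow {ι : Type*} [Fintype ι] {a b : ι → ℝ} {α : ℝ}
    (ha : ∀ i, 0 < a i) (hb : ∀ i, 0 ≤ b i) (h0 : 0 < α) (h1 : α < 1)
    (h : ∑ i, (a i ^ α + α * a i ^ (α - 1) * (b i - a i)) ≤ ∑ i, b i ^ α) : b = a := by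
  by_contra hne
  obtain ⟨i, hi⟩ := Function.ne_iff.1 hne
  exact h.not_gt (Finset.sum_lt_sum (fun j _ => rpow_le_tangent (ha j) (hb j) h0 h1)
    ⟨i, Finset.mem_univ i, rpow_lt_tangent (ha i) (hb i) hi h0 h1⟩)

theorem rpow_sum_le_sum_rpow {ι : Type*} (s : Finset ι) {f : ι → ℝ} (hf : ∀ i ∈ s, 0 ≤ f i)
    {α : ℝ} (h0 : 0 < α) (h1 : α ≤ 1) : (∑ i ∈ s, f i) ^ α ≤ ∑ i ∈ s, f i ^ α :=
  Finset.le_sum_of_subadditive_on_pred (fun t : ℝ => t ^ α) (fun t => 0 ≤ t)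
    (Real.zero_rpow h0.ne').le (fun _ _ hx hy => Real.rpow_add_le_add_rpow hx hy h0.le h1)
    (fun _ _ => add_nonneg) f hf

theorem one_sub_mul_rpow_le_add_rpow_sub {a b α : ℝ} (ha : 0 < a) (hab : a ≤ b) (h0 : 0 < α)
    (h1 : α < 1) : (1 - α) * a ^ α ≤ a ^ α + b ^ α - (a + b) ^ α := by
  have hb : 0 < b := ha.trans_le hab
  have htangent : (a + b) ^ α ≤ b ^ α + α * (b ^ (α - 1) * a) := by
    convert rpow_le_tangent hb (by positivity : 0 ≤ a + b) h0 h1 using 2; ring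
  have hslope : b ^ (α - 1) * a ≤ a ^ α := by
    calc b ^ (α - 1) * a ≤ a ^ (α - 1) * a := by
          gcongr ?_ * a; exact Real.rpow_le_rpow_of_nonpos ha hab (by linarith)
      _ = a ^ α := by rw [← Real.rpow_add_one ha.ne', sub_add_cancel]
  linarith [mul_le_mul_of_nonneg_left hslope h0.le]

/-- A measurable partition of `Q`; empty members are allowed. -/
structure IsPartition {ι X : Type*} [MeasurableSpace X] (Q : Set X) (A : ι → Set X) : Prop where
  measurableSet : ∀ i, MeasurableSet (A i)
  disjoint : Pairwise (Function.onFun Disjoint A)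
  iUnion_eq : ⋃ i, A i = Q

namespace IsPartition

variable {ι κ X : Type*} [MeasurableSpace X] {ν : Measure X} {Q B : Set X} {A : ι → Set X}

theorem subset (h : IsPartition Q A) (i : ι) : A i ⊆ Q := h.iUnion_eq ▸ Set.subset_iUnion A i

theorem exists_mem (h : IsPartition Q A) {x : X} (hx : x ∈ Q) : ∃ i, x ∈ A i := by
  rwa [← h.iUnion_eq, Set.mem_iUnion] at hx

theorem exists_measure_ne_zero [Countable ι] (h : IsPartition Q A) (hQ : ν Q ≠ 0) :
    ∃ i, ν (A i) ≠ 0 := by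
  by_contra! hzero
  exact hQ (h.iUnion_eq ▸ measure_iUnion_null hzero)

theorem eq_of_mem (h : IsPartition Q A) {i j : ι} {x : X} (hi : x ∈ A i) (hj : x ∈ A j) : i = j :=
  h.disjoint.eq (Set.not_disjoint_iff.2 ⟨x, hi, hj⟩)

theorem measure_ne_top (h : IsPartition Q A) (hQ : ν Q ≠ ⊤) (i : ι) : ν (A i) ≠ ⊤ :=
  measure_ne_top_of_subset (h.subset i) hQ

theorem sum_measureReal [Fintype ι] (h : IsPartition Q A) (hQ : ν Q ≠ ⊤) :
    ∑ i, ν.real (A i) = ν.real Q := by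
  rw [← h.iUnion_eq, measureReal_iUnion_fintype h.disjoint h.measurableSet (h.measure_ne_top hQ)]

theorem sum_setIntegral [Fintype ι] (h : IsPartition Q A) {f : X → ℝ} (hf : IntegrableOn f Q ν) :
    ∑ i, ∫ x in A i, f x ∂ν = ∫ x in Q, f x ∂ν := by
  rw [← h.iUnion_eq, integral_iUnion_fintype h.measurableSet h.disjoint
    fun i => hf.mono_set (h.subset i)]

theorem exists_measurable_map [Countable ι] [Nonempty ι] {Y : Type*} [MeasurableSpace Y]
    (h : IsPartition Q A) (p : ι → Y) : ∃ T : X → Y, Measurable T ∧ ∀ i, ∀ x ∈ A i, T x = p i :=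
  exists_measurable_piecewise A h.measurableSet (fun i _ => p i) (fun _ => measurable_const)
    fun _ _ hij _ hx => (hij (h.eq_of_mem hx.1 hx.2)).elim

theorem comp_equiv (h : IsPartition Q A) (e : κ ≃ ι) : IsPartition Q (A ∘ e) where
  measurableSet k := h.measurableSet (e k)
  disjoint _ _ hkl := h.disjoint (e.injective.ne hkl)
  iUnion_eq := (e.surjective.iUnion_comp A).trans h.iUnion_eq

theorem inter (h : IsPartition Q A) (hB : MeasurableSet B) (hBQ : B ⊆ Q) :
    IsPartition B fun i => A i ∩ B where
  measurableSet i := (h.measurableSet i).inter hB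
  disjoint _ _ hij := (h.disjoint hij).mono Set.inter_subset_left Set.inter_subset_left
  iUnion_eq := by rw [← Set.iUnion_inter, h.iUnion_eq, Set.inter_eq_right.2 hBQ]

theorem insert (h : IsPartition Q A) (hB : MeasurableSet B) (hBQ : B ⊆ Q) :
    IsPartition Q fun o : Option ι => o.elim B fun i => A i \ B where
  measurableSet
    | none => hB
    | some i => (h.measurableSet i).diff hB
  disjoint
    | none, none, hne => (hne rfl).elim
    | none, some _, _ => Set.disjoint_sdiff_right
    | some _, none, _ => Set.disjoint_sdiff_left
    | some _, some _, hne =>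
      (h.disjoint fun hij => hne (congrArg some hij)).mono Set.sdiff_subset Set.sdiff_subset
  iUnion_eq := by
    rw [Set.iUnion_option]
    simp only [Option.elim_none, Option.elim_some]
    rw [← Set.iUnion_sdiff, h.iUnion_eq, Set.union_sdiff_cancel hBQ]

theorem fiberUnion [Countable ι] (h : IsPartition Q A) (f : ι → κ) :
    IsPartition Q fun k => ⋃ i ∈ {i | f i = k}, A i where
  measurableSet k := MeasurableSet.biUnion (Set.to_countable _) fun i _ => h.measurableSet i
  disjoint k l hkl := Set.disjoint_iUnion₂_left.2 fun i hi => Set.disjoint_iUnion₂_right.2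
    fun j hj => h.disjoint fun hij => hkl (hi.symm.trans ((congrArg f hij).trans hj))
  iUnion_eq := by
    rw [← h.iUnion_eq]
    ext x
    simp

theorem measureReal_fiberUnion [Fintype ι] [DecidableEq κ] (h : IsPartition Q A) (hQ : ν Q ≠ ⊤)
    (f : ι → κ) (k : κ) :
    ν.real (⋃ i ∈ {i | f i = k}, A i) = ∑ i with f i = k, ν.real (A i) := by
  have hfinset : ⋃ i ∈ {i | f i = k}, A i = ⋃ i ∈ Finset.univ.filter (f · = k), A i := by simp
  rw [hfinset, measureReal_biUnion_finset (fun i _ j _ hij => h.disjoint hij)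
    (fun i _ => h.measurableSet i) fun i _ => h.measure_ne_top hQ i]

end IsPartition

theorem isPartition_disjointed {ι X : Type*} [MeasurableSpace X] [LinearOrder ι]
    [LocallyFiniteOrderBot ι] {Q : Set X} {A : ι → Set X} (hA : ∀ i, MeasurableSet (A i))
    (hQ : ⋃ i, A i = Q) : IsPartition Q (disjointed A) where
  measurableSet i := disjointedRec (fun _ _ ht => ht.diff (hA _)) (hA i)
  disjoint := disjoint_disjointed A
  iUnion_eq := iUnion_disjointed.trans hQ

section Moment

variable {ι κ E : Type*} [NormedAddCommGroup E] [MeasurableSpace E] {ν : Measure E}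
  {Q A : Set E}

/-- The second moment of `A` about the point `p`: the cost of moving the mass in `A` to `p`. -/
noncomputable def moment (ν : Measure E) (A : Set E) (p : E) : ℝ := ∫ x in A, ‖x - p‖ ^ 2 ∂ν

theorem moment_nonneg (ν : Measure E) (A : Set E) (p : E) : 0 ≤ moment ν A p :=
  integral_nonneg fun _ => by positivity

theorem moment_of_measure_eq_zero (hA : ν A = 0) (p : E) : moment ν A p = 0 :=
  setIntegral_measure_zero _ hA

/-- The energy `K ∑ ν(A i) ^ α + ∑ ∫_{A i} ‖x - p i‖²` of the discrete measure that has its atoms at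
the points `p i`, with masses `ν(A i)`, transported with the cells `A i`. -/
noncomputable def partitionEnergy (ν : Measure E) (K α : ℝ) {ι : Type*} [Fintype ι]
    (A : ι → Set E) (p : ι → E) : ℝ :=
  K * ∑ i, ν.real (A i) ^ α + ∑ i, moment ν (A i) (p i)

theorem partitionEnergy_nonneg {K α : ℝ} (hK : 0 ≤ K) [Fintype ι] (A : ι → Set E) (p : ι → E) :
    0 ≤ partitionEnergy ν K α A p :=
  add_nonneg (mul_nonneg hK (Finset.sum_nonneg fun _ _ => by positivity))
    (Finset.sum_nonneg fun _ _ => moment_nonneg ν _ _)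

variable [BorelSpace E] [IsFiniteMeasureOnCompacts ν]

theorem integrableOn_norm_sub_sq (hQ : IsCompact Q) (hA : A ⊆ Q) (p : E) :
    IntegrableOn (fun x => ‖x - p‖ ^ 2) A ν :=
  (ContinuousOn.integrableOn_compact hQ (by fun_prop)).mono_set hA

theorem setIntegral_norm_sub_sq_sub (hQ : IsCompact Q) (hA : A ⊆ Q) (p : E) (w : ℝ) :
    ∫ x in A, (‖x - p‖ ^ 2 - w) ∂ν = moment ν A p - w * ν.real A := by
  have hfin : ν A ≠ ⊤ := measure_ne_top_of_subset hA hQ.measure_ne_top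
  rw [integral_sub (integrableOn_norm_sub_sq hQ hA p) (integrableOn_const hfin),
    setIntegral_const, smul_eq_mul, mul_comm w, moment]

theorem mul_measureReal_le_moment (hQ : IsCompact Q) (hA : A ⊆ Q) (hAm : MeasurableSet A) {p : E}
    {c : ℝ} (hc : ∀ x ∈ A, c ≤ ‖x - p‖ ^ 2) : c * ν.real A ≤ moment ν A p :=
  setIntegral_ge_of_const_le_real hAm (measure_ne_top_of_subset hA hQ.measure_ne_top) hc
    (integrableOn_norm_sub_sq hQ hA p)

theorem moment_le_mul_measureReal (hQ : IsCompact Q) (hA : A ⊆ Q) (hAm : MeasurableSet A) {p : E}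
    {c : ℝ} (hc : ∀ x ∈ A, ‖x - p‖ ^ 2 ≤ c) : moment ν A p ≤ c * ν.real A := by
  have hfin : ν A ≠ ⊤ := measure_ne_top_of_subset hA hQ.measure_ne_top
  rw [mul_comm, ← smul_eq_mul, ← setIntegral_const]
  exact setIntegral_mono_on (integrableOn_norm_sub_sq hQ hA p) (integrableOn_const hfin) hAm hc

namespace IsPartition

variable {A : ι → Set E}

theorem lintegral_eq_sum_moment [Fintype ι] (h : IsPartition Q A) (hQ : IsCompact Q) (p : ι → E)
    {T : E → E} (hT : ∀ i, ∀ x ∈ A i, T x = p i) :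
    ∫⁻ x in Q, ENNReal.ofReal (‖x - T x‖ ^ 2) ∂ν =
      ENNReal.ofReal (∑ i, moment ν (A i) (p i)) := by
  rw [← h.iUnion_eq, lintegral_iUnion h.measurableSet h.disjoint, tsum_fintype,
    ENNReal.ofReal_sum_of_nonneg fun i _ => moment_nonneg ν _ _]
  refine Finset.sum_congr rfl fun i _ => ?_
  rw [moment, ofReal_integral_eq_lintegral_ofReal (integrableOn_norm_sub_sq hQ (h.subset i) _)
    (ae_of_all _ fun x => by positivity)]
  exact setLIntegral_congr_fun (h.measurableSet i) fun x hx => by simp only [hT i x hx]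

theorem sum_moment_fiberUnion [Fintype ι] [Fintype κ] (h : IsPartition Q A) (hQ : IsCompact Q)
    (f : ι → κ) (p : κ → E) :
    ∑ k, moment ν (⋃ i ∈ {i | f i = k}, A i) (p k) = ∑ i, moment ν (A i) (p (f i)) := by
  classical
  rw [← Finset.sum_fiberwise Finset.univ f]
  refine Finset.sum_congr rfl fun k _ => ?_
  have hfinset : ⋃ i ∈ {i | f i = k}, A i = ⋃ i ∈ Finset.univ.filter (f · = k), A i := by simp
  rw [hfinset, moment, integral_biUnion_finset _ (fun i _ => h.measurableSet i)
    (fun i _ j _ hij => h.disjoint hij)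
    fun i _ => integrableOn_norm_sub_sq hQ (h.subset i) (p k)]
  exact Finset.sum_congr rfl fun i hi => by rw [(Finset.mem_filter.1 hi).2, moment]

end IsPartition

theorem IsPartition.partitionEnergy_fiberUnion_le {K α : ℝ} [Fintype ι] [Fintype κ]
    {A : ι → Set E} (h : IsPartition Q A) (hQ : IsCompact Q) (hK : 0 ≤ K) (h0 : 0 < α)
    (h1 : α ≤ 1) (f : ι → κ) (p : κ → E) :
    partitionEnergy ν K α (fun k => ⋃ i ∈ {i | f i = k}, A i) p ≤
      partitionEnergy ν K α A (p ∘ f) := by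
  classical
  refine add_le_add (mul_le_mul_of_nonneg_left ?_ hK) (h.sum_moment_fiberUnion hQ f p).le
  rw [← Finset.sum_fiberwise Finset.univ f]
  refine Finset.sum_le_sum fun k _ => ?_
  rw [h.measureReal_fiberUnion hQ.measure_ne_top]
  exact rpow_sum_le_sum_rpow _ (fun _ _ => measureReal_nonneg) h0 h1

end Moment

theorem IsPartition.sum_setIntegral_le_of_argmin {ι X : Type*} [Fintype ι] [MeasurableSpace X]
    {ν : Measure X} {Q : Set X} {A C : ι → Set X} {f : ι → X → ℝ}
    (hA : IsPartition Q A) (hC : IsPartition Q C) (hf : ∀ i, IntegrableOn (f i) Q ν)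
    (hmin : ∀ i, ∀ x ∈ C i, ∀ j, f i x ≤ f j x) :
    ∑ i, ∫ x in C i, f i x ∂ν ≤ ∑ i, ∫ x in A i, f i x ∂ν ∧
    (∑ i, ∫ x in C i, f i x ∂ν = ∑ i, ∫ x in A i, f i x ∂ν →
      ∀ᵐ x ∂ν, ∀ i, x ∈ A i → ∀ j, f i x ≤ f j x) := by
  set φ : X → ℝ := fun x => ⨅ i, f i x
  have hφ_le : ∀ x i, φ x ≤ f i x := fun x => ciInf_le (Set.finite_range _).bddBelow
  have hφ_eq : ∀ i, Set.EqOn (f i) φ (C i) := fun i x hx =>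
    have : Nonempty ι := ⟨i⟩
    le_antisymm (le_ciInf (hmin i x hx)) (hφ_le x i)
  have hφ : IntegrableOn φ Q ν := by
    rw [← hC.iUnion_eq, integrableOn_finite_iUnion]
    exact fun i => ((hf i).mono_set (hC.subset i)).congr_fun (hφ_eq i) (hC.measurableSet i)
  have hφA : ∀ i, IntegrableOn φ (A i) ν := fun i => hφ.mono_set (hA.subset i)
  have hfA : ∀ i, IntegrableOn (f i) (A i) ν := fun i => (hf i).mono_set (hA.subset i)
  have hsum : ∑ i, ∫ x in C i, f i x ∂ν = ∑ i, ∫ x in A i, φ x ∂ν := by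
    rw [hA.sum_setIntegral hφ, ← hC.sum_setIntegral hφ]
    exact Finset.sum_congr rfl fun i _ => setIntegral_congr_fun (hC.measurableSet i) (hφ_eq i)
  have hmono : ∀ i ∈ Finset.univ, ∫ x in A i, φ x ∂ν ≤ ∫ x in A i, f i x ∂ν := fun i _ =>
    integral_mono (hφA i) (hfA i) fun x => hφ_le x i
  rw [hsum]
  refine ⟨Finset.sum_le_sum hmono, fun heq => ae_all_iff.2 fun i => ?_⟩
  have hzero : ∫ x in A i, (f i x - φ x) ∂ν = 0 := by
    rw [integral_sub (hfA i) (hφA i), sub_eq_zero]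
    exact ((Finset.sum_eq_sum_iff_of_le hmono).1 heq i (Finset.mem_univ i)).symm
  have hae := (integral_eq_zero_iff_of_nonneg (fun x => sub_nonneg.2 (hφ_le x i))
    ((hfA i).sub (hφA i))).1 hzero
  filter_upwards [(ae_restrict_iff' (hA.measurableSet i)).1 hae] with x hx hxA j
  exact (sub_eq_zero.1 (hx hxA)).trans_le (hφ_le x j)

section PowerCell

variable {ι E : Type*}

theorem subset_closure_of_convex_of_ae [NormedAddCommGroup E] [NormedSpace ℝ E]
    [FiniteDimensional ℝ E] [MeasurableSpace E] [BorelSpace E] {ν : Measure E}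
    [ν.IsAddHaarMeasure] {C D : Set E} (hC : Convex ℝ C) (hpos : ν C ≠ 0)
    (hCD : ∀ᵐ x ∂ν, x ∈ C → x ∈ D) : C ⊆ closure D := by
  have hint : (interior C).Nonempty := by
    rw [Set.nonempty_iff_ne_empty]
    intro hempty
    refine hpos (measure_mono_null ?_ (hC.addHaar_frontier ν))
    rw [frontier, hempty, Set.sdiff_empty]
    exact subset_closure
  calc C ⊆ closure C := subset_closure
    _ = closure (interior C) := (hC.closure_interior_eq_closure_of_nonempty_interior hint).symm
    _ ⊆ closure D := closure_minimal
        (((Measure.dense_of_ae hCD).open_subset_closure_inter isOpen_interior).trans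
          (closure_mono fun _ hx => hx.2 (interior_subset hx.1))) isClosed_closure

/-- The power (Laguerre) cell in `Q` of the `i`-th of the points `z`, for the weights `w`. -/
def powerCell [Norm E] [Sub E] (Q : Set E) (z : ι → E) (w : ι → ℝ) (i : ι) : Set E :=
  {x ∈ Q | ∀ j, ‖x - z i‖ ^ 2 - w i ≤ ‖x - z j‖ ^ 2 - w j}

section Normed

variable [NormedAddCommGroup E] {Q : Set E} {z : ι → E} {w : ι → ℝ}

theorem powerCell_subset (i : ι) : powerCell Q z w i ⊆ Q := Set.sep_subset _ _

theorem powerCell_eq_inter (i : ι) : powerCell Q z w i =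
    Q ∩ ⋂ j, {x | ‖x - z i‖ ^ 2 - w i ≤ ‖x - z j‖ ^ 2 - w j} := by
  ext x
  simp [powerCell]

theorem isClosed_powerCell (hQ : IsClosed Q) (i : ι) : IsClosed (powerCell Q z w i) := by
  rw [powerCell_eq_inter]
  exact hQ.inter (isClosed_iInter fun j => isClosed_le (by fun_prop) (by fun_prop))

theorem iUnion_powerCell [Finite ι] [Nonempty ι] : ⋃ i, powerCell Q z w i = Q := by
  refine subset_antisymm (Set.iUnion_subset powerCell_subset) fun x hx => ?_
  obtain ⟨i, hi⟩ := Finite.exists_min fun j => ‖x - z j‖ ^ 2 - w j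
  exact Set.mem_iUnion.2 ⟨i, hx, hi⟩

theorem isPartition_disjointed_powerCell [MeasurableSpace E] [BorelSpace E] [Finite ι]
    [Nonempty ι] [LinearOrder ι] [LocallyFiniteOrderBot ι] (hQ : IsClosed Q) :
    IsPartition Q (disjointed (powerCell Q z w)) :=
  isPartition_disjointed (fun i => (isClosed_powerCell hQ i).measurableSet) iUnion_powerCell

variable [MeasurableSpace E] [BorelSpace E] {ν : Measure E} [IsFiniteMeasureOnCompacts ν]
  [Fintype ι] {A C : ι → Set E}

theorem IsPartition.sum_moment_sub_le_of_subset_powerCell (hA : IsPartition Q A)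
    (hC : IsPartition Q C) (hQ : IsCompact Q) (hmin : ∀ i, C i ⊆ powerCell Q z w i) :
    ∑ i, (moment ν (C i) (z i) - w i * ν.real (C i)) ≤
        ∑ i, (moment ν (A i) (z i) - w i * ν.real (A i)) ∧
      (∑ i, (moment ν (C i) (z i) - w i * ν.real (C i)) =
          ∑ i, (moment ν (A i) (z i) - w i * ν.real (A i)) →
        ∀ᵐ x ∂ν, ∀ i, x ∈ A i → x ∈ powerCell Q z w i) := by
  have hle := hA.sum_setIntegral_le_of_argmin (ν := ν) hC
    (f := fun i x => ‖x - z i‖ ^ 2 - w i)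
    (fun i => ContinuousOn.integrableOn_compact hQ (by fun_prop)) fun i x hx => (hmin i hx).2
  simp only [fun i => setIntegral_norm_sub_sq_sub (ν := ν) hQ (hA.subset i) (z i) (w i),
    fun i => setIntegral_norm_sub_sq_sub (ν := ν) hQ (hC.subset i) (z i) (w i)] at hle
  refine ⟨hle.1, fun heq => ?_⟩
  filter_upwards [hle.2 heq] with x hx i hxA
  exact ⟨hA.subset i hxA, hx i hxA⟩

end Normed

section InnerProduct

variable [NormedAddCommGroup E] [InnerProductSpace ℝ E] {Q : Set E} {z : ι → E} {w : ι → ℝ}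

theorem norm_sub_sq_sub_norm_sub_sq (x a b : E) :
    ‖x - a‖ ^ 2 - ‖x - b‖ ^ 2 = 2 * inner ℝ (b - a) x + (‖a‖ ^ 2 - ‖b‖ ^ 2) := by
  rw [norm_sub_sq_real, norm_sub_sq_real, inner_sub_left, real_inner_comm x a, real_inner_comm x b]
  ring

theorem convex_powerCell (hQ : Convex ℝ Q) (i : ι) : Convex ℝ (powerCell Q z w i) := by
  rw [powerCell_eq_inter]
  refine hQ.inter (convex_iInter fun j => ?_)
  have hhalfspace : {x | ‖x - z i‖ ^ 2 - w i ≤ ‖x - z j‖ ^ 2 - w j} =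
      {x | innerSL ℝ (z j - z i) x ≤ (w i - w j - (‖z i‖ ^ 2 - ‖z j‖ ^ 2)) / 2} := by
    ext x
    have hx := norm_sub_sq_sub_norm_sub_sq x (z i) (z j)
    simp only [Set.mem_ofPred_eq, innerSL_apply_apply]
    constructor <;> intro h <;> linarith
  rw [hhalfspace]
  exact convex_halfSpace_le (innerSL ℝ (z j - z i)).toLinearMap.isLinear _

variable [FiniteDimensional ℝ E] [MeasurableSpace E] [BorelSpace E] {ν : Measure E}
  [ν.IsAddHaarMeasure]

theorem measure_norm_sub_sq_sub_eq {a b : E} (hab : a ≠ b) (u v : ℝ) :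
    ν {x | ‖x - a‖ ^ 2 - u = ‖x - b‖ ^ 2 - v} = 0 := by
  set S := {x | ‖x - a‖ ^ 2 - u = ‖x - b‖ ^ 2 - v}
  rcases S.eq_empty_or_nonempty with hS | ⟨y, hy⟩
  · rw [hS, measure_empty]
  have hker : (innerSL ℝ (b - a)).toLinearMap.ker ≠ ⊤ := fun htop => by
    have hmem : b - a ∈ (innerSL ℝ (b - a)).toLinearMap.ker := htop ▸ Submodule.mem_top
    have hself : inner ℝ (b - a) (b - a) = 0 := hmem
    exact hab (sub_eq_zero.1 (inner_self_eq_zero.1 hself)).symm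
  have hsub : S ⊆ (fun x => x + -y) ⁻¹' ((innerSL ℝ (b - a)).toLinearMap.ker : Set E) := by
    intro x (hx : ‖x - a‖ ^ 2 - u = ‖x - b‖ ^ 2 - v)
    have hy : ‖y - a‖ ^ 2 - u = ‖y - b‖ ^ 2 - v := hy
    change inner ℝ (b - a) (x + -y) = 0
    rw [← sub_eq_add_neg, inner_sub_right]
    linarith [norm_sub_sq_sub_norm_sub_sq x a b, norm_sub_sq_sub_norm_sub_sq y a b]
  refine measure_mono_null hsub ?_
  rw [measure_preimage_add_right, Measure.addHaar_submodule ν _ hker]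

theorem ae_eq_of_mem_powerCell [Countable ι] (hz : Function.Injective z) :
    ∀ᵐ x ∂ν, ∀ i j, x ∈ powerCell Q z w i → x ∈ powerCell Q z w j → i = j := by
  refine ae_all_iff.2 fun i => ae_all_iff.2 fun j => ?_
  by_cases hij : i = j
  · simp [hij]
  · filter_upwards [measure_eq_zero_iff_ae_notMem.1 (measure_norm_sub_sq_sub_eq (ν := ν)
      (hz.ne hij) (w i) (w j))] with x hx hi hj
    exact (hx (le_antisymm (hi.2 j) (hj.2 i))).elim

theorem IsPartition.ae_mem_iff_mem_powerCell [Countable ι] {A : ι → Set E}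
    (hA : IsPartition Q A) (hz : Function.Injective z)
    (hsub : ∀ᵐ x ∂ν, ∀ i, x ∈ A i → x ∈ powerCell Q z w i) :
    ∀ᵐ x ∂ν, ∀ i, x ∈ A i ↔ x ∈ powerCell Q z w i := by
  filter_upwards [hsub, ae_eq_of_mem_powerCell hz] with x hx huniq i
  refine ⟨hx i, fun hi => ?_⟩
  obtain ⟨j, hj⟩ := hA.exists_mem hi.1
  rwa [huniq i j hi (hx j hj)]

theorem IsPartition.closure_eq_powerCell [Countable ι] {A : ι → Set E} (hA : IsPartition Q A)
    (hQ : IsClosed Q) (hconv : Convex ℝ Q) (hz : Function.Injective z)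
    (hsub : ∀ i, A i ⊆ powerCell Q z w i) {i : ι} (hi : ν (A i) ≠ 0) :
    closure (A i) = powerCell Q z w i := by
  refine (closure_minimal (hsub i) (isClosed_powerCell hQ i)).antisymm
    (subset_closure_of_convex_of_ae (convex_powerCell hconv i)
      (fun h => hi (measure_mono_null (hsub i) h)) (ν := ν) ?_)
  filter_upwards [hA.ae_mem_iff_mem_powerCell (ν := ν) hz (ae_of_all _ fun x j hx => hsub j hx)]
    with x hx
  exact (hx i).2

end InnerProduct

end PowerCell

theorem moment_eq_moment_average_add {E : Type*} [NormedAddCommGroup E] [InnerProductSpace ℝ E]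
    [CompleteSpace E] [MeasurableSpace E] [BorelSpace E] {ν : Measure E}
    [IsFiniteMeasureOnCompacts ν] {Q A : Set E} (hQ : IsCompact Q) (hA : A ⊆ Q) (p : E) :
    moment ν A p = moment ν A (⨍ x in A, x ∂ν) + ν.real A * ‖(⨍ x in A, x ∂ν) - p‖ ^ 2 := by
  have hfin : ν A ≠ ⊤ := measure_ne_top_of_subset hA hQ.measure_ne_top
  rcases eq_or_ne (ν A) 0 with hzero | hne
  · simp [moment_of_measure_eq_zero hzero, measureReal_def, hzero]
  have hid : IntegrableOn (fun x => x) A ν :=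
    (continuousOn_id.integrableOn_compact hQ).mono_set hA
  set b := ⨍ x in A, x ∂ν with hb
  have hdev : IntegrableOn (fun x => x - b) A ν := hid.sub (integrableOn_const hfin)
  have hmean : ∫ x in A, (x - b) ∂ν = 0 := by
    rw [integral_sub hid (integrableOn_const hfin), setIntegral_const, hb, setAverage_eq,
      smul_smul, mul_inv_cancel₀ ((measureReal_ne_zero_iff hfin).2 hne), one_smul, sub_self]
  have hcross : ∫ x in A, inner ℝ (b - p) (x - b) ∂ν = 0 := by
    rw [integral_inner hdev, hmean, inner_zero_right]
  have hlin : IntegrableOn (fun x => 2 * inner ℝ (b - p) (x - b)) A ν :=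
    (hdev.const_inner _).const_mul 2
  have hrest : IntegrableOn (fun x => 2 * inner ℝ (b - p) (x - b) + ‖b - p‖ ^ 2) A ν :=
    hlin.add (integrableOn_const hfin)
  calc moment ν A p
      = ∫ x in A, (‖x - b‖ ^ 2 + (2 * inner ℝ (b - p) (x - b) + ‖b - p‖ ^ 2)) ∂ν := by
        refine integral_congr_ae (ae_of_all _ fun x => ?_)
        beta_reduce
        rw [← sub_add_sub_cancel x b p, norm_add_sq_real, real_inner_comm]
        ring
    _ = moment ν A b + ν.real A * ‖b - p‖ ^ 2 := by
        rw [integral_add (integrableOn_norm_sub_sq hQ hA b) hrest,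
          integral_add hlin (integrableOn_const hfin), integral_const_mul, hcross,
          setIntegral_const, smul_eq_mul, mul_zero, zero_add, moment]

theorem IsPartition.sum_rpow_fiberUnion_update {ι X : Type*} [Fintype ι] [DecidableEq ι]
    [MeasurableSpace X] {ν : Measure X} {Q : Set X} {A : ι → Set X} (h : IsPartition Q A)
    (hQ : ν Q ≠ ⊤) {α : ℝ} (hα : α ≠ 0) {i j : ι} (hij : i ≠ j) :
    ∑ k, ν.real (⋃ l ∈ {l | Function.update id i j l = k}, A l) ^ α - ∑ k, ν.real (A k) ^ α =
      (ν.real (A i) + ν.real (A j)) ^ α - ν.real (A i) ^ α - ν.real (A j) ^ α := by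
  simp only [h.measureReal_fiberUnion hQ]
  have hi : Finset.univ.filter (Function.update id i j · = i) = ∅ := by
    ext l
    by_cases hl : l = i <;> simp [hl, hij.symm]
  have hj : Finset.univ.filter (Function.update id i j · = j) = {i, j} := by
    ext l
    by_cases hl : l = i <;> simp [hl]
  rw [← Finset.sum_sub_distrib, Fintype.sum_eq_add i j hij]
  · rw [hi, hj, Finset.sum_empty, Real.zero_rpow hα, Finset.sum_pair hij]
    ring
  · rintro k ⟨hki, hkj⟩
    have hk : Finset.univ.filter (Function.update id i j · = k) = {k} := by
      ext l
      by_cases hl : l = i <;> simp [hl, hki.symm, hkj.symm]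
    rw [hk, Finset.sum_singleton, sub_self]

/-- A partition `A` of `Q` with points `z i ∈ Q` that has the least energy among all finite
partitions of `Q` with points in `Q`; neither distinct points nor cells of positive measure are
required of the competitors. -/
structure IsOptimalPartition {E : Type*} [NormedAddCommGroup E] [MeasurableSpace E]
    (ν : Measure E) (K α : ℝ) (Q : Set E) {ι : Type} [Fintype ι] (A : ι → Set E) (z : ι → E) :
    Prop where
  isPartition : IsPartition Q A
  mem : ∀ i, z i ∈ Q
  energy_le : ∀ {κ : Type} [Fintype κ] {B : κ → Set E} {p : κ → E}, IsPartition Q B →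
    (∀ k, p k ∈ Q) → partitionEnergy ν K α A z ≤ partitionEnergy ν K α B p

namespace IsOptimalPartition

section Normed

variable {E : Type*} [NormedAddCommGroup E] [MeasurableSpace E] [BorelSpace E] {ν : Measure E}
  [IsFiniteMeasureOnCompacts ν] {K α : ℝ} {Q : Set E} {ι : Type} [Fintype ι] {A : ι → Set E}
  {z : ι → E}

theorem sum_moment_inter_le (h : IsOptimalPartition ν K α Q A z) (hQ : IsCompact Q) (hK : 0 ≤ K)
    (hα : 0 ≤ α) {B : Set E} (hB : MeasurableSet B) (hBQ : B ⊆ Q) {c : E} (hc : c ∈ Q) :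
    ∑ i, moment ν (A i ∩ B) (z i) ≤ K * ν.real B ^ α + moment ν B c := by
  have hle := h.energy_le (h.isPartition.insert hB hBQ) (p := fun o => o.elim c z)
    (Option.forall.2 ⟨hc, h.mem⟩)
  simp only [partitionEnergy, Fintype.sum_option, Option.elim_none, Option.elim_some] at hle
  have hmass : K * ∑ i, ν.real (A i \ B) ^ α ≤ K * ∑ i, ν.real (A i) ^ α := by
    gcongr with i
    · exact h.isPartition.measure_ne_top hQ.measure_ne_top i
    · exact Set.sdiff_subset
  have hsplit : ∀ i, moment ν (A i ∩ B) (z i) + moment ν (A i \ B) (z i) =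
      moment ν (A i) (z i) := fun i =>
    integral_inter_add_sdiff hB (integrableOn_norm_sub_sq hQ (h.isPartition.subset i) (z i))
  simp only [← hsplit, Finset.sum_add_distrib] at hle
  linarith

theorem mul_measureReal_closedBall_le (h : IsOptimalPartition ν K α Q A z) (hQ : IsCompact Q)
    (hK : 0 ≤ K) (hα : 0 ≤ α) {c : E} {r R : ℝ} (hr : 0 ≤ r) (hrR : r < R)
    (hsub : Metric.ball c R ⊆ Q) (hfar : ∀ i, R ≤ dist (z i) c) :
    (R ^ 2 - 2 * R * r) * ν.real (Metric.closedBall c r) ≤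
      K * ν.real (Metric.closedBall c r) ^ α := by
  set B := Metric.closedBall c r
  have hBQ : B ⊆ Q := (Metric.closedBall_subset_ball hrR).trans hsub
  have hB : MeasurableSet B := measurableSet_closedBall
  have hinter := h.isPartition.inter hB hBQ
  have hBfin : ν B ≠ ⊤ := measure_ne_top_of_subset hBQ hQ.measure_ne_top
  have hnew : moment ν B c ≤ r ^ 2 * ν.real B := by
    refine moment_le_mul_measureReal hQ hBQ hB fun x hx => ?_
    gcongr
    exact mem_closedBall_iff_norm.1 hx
  have hold : (R - r) ^ 2 * ν.real B ≤ ∑ i, moment ν (A i ∩ B) (z i) := by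
    rw [← hinter.sum_measureReal hBfin, Finset.mul_sum]
    refine Finset.sum_le_sum fun i _ => mul_measureReal_le_moment hQ ((hinter.subset i).trans hBQ)
      (hinter.measurableSet i) fun x hx => ?_
    have hxc : dist x c ≤ r := hx.2
    have htri := dist_triangle_left (z i) c x
    rw [dist_eq_norm x (z i)] at htri
    exact pow_le_pow_left₀ (by linarith) (by linarith [hfar i]) 2
  have hinsert := h.sum_moment_inter_le hQ hK hα hB hBQ (hBQ (Metric.mem_closedBall_self hr))
  linarith

end Normed

section InnerProduct

variable {E : Type*} [NormedAddCommGroup E] [InnerProductSpace ℝ E] [CompleteSpace E]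
  [MeasurableSpace E] [BorelSpace E] {ν : Measure E} [IsFiniteMeasureOnCompacts ν] {K α : ℝ}
  {Q : Set E} {ι : Type} [Fintype ι] {A : ι → Set E} {z : ι → E}

theorem average_eq (h : IsOptimalPartition ν K α Q A z) (hQ : IsCompact Q) (hconv : Convex ℝ Q)
    {i : ι} (hi : ν (A i) ≠ 0) : ⨍ x in A i, x ∂ν = z i := by
  classical
  have hAi := h.isPartition.subset i
  have hfin : ν (A i) ≠ ⊤ := h.isPartition.measure_ne_top hQ.measure_ne_top i
  set b := ⨍ x in A i, x ∂ν
  have hb : b ∈ Q := hconv.set_average_mem hQ.isClosed hi hfin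
    ((ae_restrict_iff' (h.isPartition.measurableSet i)).2 (ae_of_all _ fun x hx => hAi hx))
    ((continuousOn_id.integrableOn_compact hQ).mono_set hAi)
  have hle := h.energy_le h.isPartition (p := Function.update z i b)
    (Function.forall_update_iff z (p := fun _ y => y ∈ Q) |>.2 ⟨hb, fun k _ => h.mem k⟩)
  have hsum : ∑ k, moment ν (A k) (Function.update z i b k) - ∑ k, moment ν (A k) (z k) =
      moment ν (A i) b - moment ν (A i) (z i) := by
    rw [← Finset.sum_sub_distrib, Fintype.sum_eq_single i, Function.update_self]
    intro k hk
    rw [Function.update_of_ne hk, sub_self]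
  have hnonpos : ν.real (A i) * ‖b - z i‖ ^ 2 ≤ 0 := by
    unfold partitionEnergy at hle
    linarith [moment_eq_moment_average_add (ν := ν) hQ hAi (z i)]
  have hpos : 0 < ν.real (A i) := ENNReal.toReal_pos hi hfin
  have hnorm := nonpos_of_mul_nonpos_right hnonpos hpos
  exact sub_eq_zero.1 (norm_eq_zero.1 (pow_eq_zero_iff two_ne_zero |>.1
    (le_antisymm hnorm (sq_nonneg _))))

theorem moment_eq (h : IsOptimalPartition ν K α Q A z) (hQ : IsCompact Q) (hconv : Convex ℝ Q)
    {i : ι} (hi : ν (A i) ≠ 0) (p : E) :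
    moment ν (A i) p = moment ν (A i) (z i) + ν.real (A i) * ‖z i - p‖ ^ 2 := by
  rw [moment_eq_moment_average_add hQ (h.isPartition.subset i) p, h.average_eq hQ hconv hi]

theorem absorb_le (h : IsOptimalPartition ν K α Q A z) (hQ : IsCompact Q) (hconv : Convex ℝ Q)
    (hα : α ≠ 0) {i j : ι} (hij : i ≠ j) (hi : ν (A i) ≠ 0) :
    K * (ν.real (A i) ^ α + ν.real (A j) ^ α - (ν.real (A i) + ν.real (A j)) ^ α) ≤
      ν.real (A i) * ‖z i - z j‖ ^ 2 := by
  classical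
  have hle := h.energy_le (h.isPartition.fiberUnion (Function.update id i j)) h.mem
  have hmoment : ∑ k, moment ν (A k) (z (Function.update id i j k)) -
      ∑ k, moment ν (A k) (z k) = moment ν (A i) (z j) - moment ν (A i) (z i) := by
    rw [← Finset.sum_sub_distrib, Fintype.sum_eq_single i]
    · simp
    · intro k hk
      simp [hk]
  have hmass := h.isPartition.sum_rpow_fiberUnion_update (ν := ν) hQ.measure_ne_top hα hij
  rw [partitionEnergy, partitionEnergy, h.isPartition.sum_moment_fiberUnion hQ _ z] at hle
  linear_combination hle + hmoment + h.moment_eq hQ hconv hi (z j) + K * hmass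

theorem mul_le_norm_sub_sq_mul_rpow (h : IsOptimalPartition ν K α Q A z) (hQ : IsCompact Q)
    (hconv : Convex ℝ Q) (hK : 0 ≤ K) (h0 : 0 < α) (h1 : α < 1) (hpos : ∀ i, ν (A i) ≠ 0)
    {i j : ι} (hij : i ≠ j) :
    K * (1 - α) ≤ ‖z i - z j‖ ^ 2 * ν.real (A i) ^ (1 - α) := by
  have hm : ∀ k, 0 < ν.real (A k) := fun k =>
    ENNReal.toReal_pos (hpos k) (h.isPartition.measure_ne_top hQ.measure_ne_top k)
  have hlight : ∀ k l, k ≠ l → ν.real (A k) ≤ ν.real (A l) →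
      K * (1 - α) ≤ ‖z k - z l‖ ^ 2 * ν.real (A k) ^ (1 - α) := fun k l hkl hle => by
    refine le_of_mul_le_mul_right ?_ (Real.rpow_pos_of_pos (hm k) α)
    calc K * (1 - α) * ν.real (A k) ^ α
        = K * ((1 - α) * ν.real (A k) ^ α) := mul_assoc _ _ _
      _ ≤ K * (ν.real (A k) ^ α + ν.real (A l) ^ α - (ν.real (A k) + ν.real (A l)) ^ α) := by
        gcongr
        exact one_sub_mul_rpow_le_add_rpow_sub (hm k) hle h0 h1
      _ ≤ ν.real (A k) * ‖z k - z l‖ ^ 2 := h.absorb_le hQ hconv h0.ne' hkl (hpos k)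
      _ = ‖z k - z l‖ ^ 2 * ν.real (A k) ^ (1 - α) * ν.real (A k) ^ α := by
        rw [mul_assoc, ← Real.rpow_add (hm k), sub_add_cancel, Real.rpow_one, mul_comm]
  rcases le_total (ν.real (A i)) (ν.real (A j)) with hle | hle
  · exact hlight i j hij hle
  · rw [norm_sub_rev]
    refine (hlight j i hij.symm hle).trans ?_
    gcongr

theorem mul_le_dist_add_sq_mul_rpow (h : IsOptimalPartition ν K α Q A z) (hQ : IsCompact Q)
    (hconv : Convex ℝ Q) (hK : 0 ≤ K) (h0 : 0 < α) (h1 : α < 1) (hpos : ∀ i, ν (A i) ≠ 0)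
    {i j : ι} {c : E} {R : ℝ} (hi : R ≤ dist (z i) c) (hj : dist (z j) c < R) :
    K * (1 - α) ≤ (dist (z i) c + R) ^ 2 * ν.real (A i) ^ (1 - α) := by
  have hij : i ≠ j := by
    rintro rfl
    exact hj.not_ge hi
  refine (h.mul_le_norm_sub_sq_mul_rpow hQ hconv hK h0 h1 hpos hij).trans ?_
  rw [← dist_eq_norm]
  gcongr
  linarith [dist_triangle_right (z i) (z j) c]

end InnerProduct

end IsOptimalPartition

theorem ball_subset_of_le_infDist_frontier {E : Type*} [NormedAddCommGroup E] [NormedSpace ℝ E]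
    [FiniteDimensional ℝ E] {Q : Set E} {x : E} {r : ℝ} (hx : x ∈ Q)
    (hr : r ≤ Metric.infDist x (frontier Q)) : Metric.ball x r ⊆ Q := by
  intro y hy
  by_contra hyQ
  obtain ⟨b, hb, hxb⟩ := exists_mem_frontier_infDist_compl_eq_dist hx fun huniv =>
    hyQ (huniv ▸ Set.mem_univ y)
  have hxy : Metric.infDist x Qᶜ ≤ dist x y := Metric.infDist_le_dist_of_mem hyQ
  have hfrontier : Metric.infDist x (frontier Q) ≤ dist x b := Metric.infDist_le_dist_of_mem hb
  linarith [Metric.mem_ball'.1 hy]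

theorem unitSquare_eq_preimage : unitSquare = EuclideanSpace.equiv (Fin 2) ℝ ⁻¹'
    Set.Icc (fun _ => -(1 / 2)) (fun _ => 1 / 2) := by
  ext x
  simp [unitSquare, Pi.le_def, forall_and]

theorem isCompact_unitSquare : IsCompact unitSquare := by
  rw [unitSquare_eq_preimage]
  exact (EuclideanSpace.equiv (Fin 2) ℝ).toHomeomorph.isCompact_preimage.2 isCompact_Icc

theorem convex_unitSquare : Convex ℝ unitSquare := by
  rw [unitSquare_eq_preimage]
  exact (convex_Icc _ _).linear_preimage (EuclideanSpace.equiv (Fin 2) ℝ).toLinearMap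

theorem volume_unitSquare : volume unitSquare = 1 := by
  rw [unitSquare_eq_preimage]
  refine ((PiLp.volume_preserving_ofLp (Fin 2)).measure_preimage
    measurableSet_Icc.nullMeasurableSet).trans ?_
  rw [Real.volume_Icc_pi]
  norm_num

theorem mem_smul_unitSquare_iff {s : ℝ} (hs : 0 < s) {x : Plane} :
    x ∈ s • unitSquare ↔ ∀ k, |x k| ≤ s / 2 := by
  rw [Set.mem_smul_set_iff_inv_smul_mem₀ hs.ne']
  refine forall_congr' fun k => ?_
  rw [PiLp.smul_apply, smul_eq_mul, Set.mem_Icc, ← abs_le, abs_mul, abs_of_pos (inv_pos.2 hs),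
    inv_mul_le_iff₀ hs, mul_one_div]

theorem exists_ball_subset_smul_unitSquare {s ρ : ℝ} (hs : 0 < s) (hρ : 4 * ρ ≤ s) {x : Plane}
    (hx : x ∈ s • unitSquare) :
    ∃ c, Metric.ball c ρ ⊆ s • unitSquare ∧ ‖x - c‖ ^ 2 = 2 * ρ ^ 2 := by
  rw [mem_smul_unitSquare_iff hs] at hx
  refine ⟨WithLp.toLp 2 fun k => if 0 ≤ x k then x k - ρ else x k + ρ, fun y hy => ?_, ?_⟩
  · refine (mem_smul_unitSquare_iff hs).2 fun k => ?_
    have hyk := (PiLp.norm_apply_le _ k).trans (mem_ball_iff_norm.1 hy).le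
    have hxk := abs_le.1 (hx k)
    simp only [PiLp.sub_apply, Real.norm_eq_abs] at hyk
    rw [abs_le] at hyk ⊢
    split_ifs at hyk <;> constructor <;> linarith [hyk.1, hyk.2, hxk.1, hxk.2]
  · rw [EuclideanSpace.real_norm_sq_eq, Fin.sum_univ_two]
    simp only [PiLp.sub_apply]
    split_ifs <;> ring

theorem c6_pos : 0 < c6 := by unfold c6; positivity

variable {δ α : ℝ}

theorem vol_pos (hδ : 0 < δ) (h1 : α < 1) : 0 < vol δ α :=
  Real.rpow_pos_of_pos (div_pos c6_pos (mul_pos hδ (sub_pos.2 h1))) _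

theorem isCompact_square (δ α : ℝ) : IsCompact (square δ α) := isCompact_unitSquare.smul _

theorem convex_square (δ α : ℝ) : Convex ℝ (square δ α) := convex_unitSquare.smul _

theorem volume_square (hδ : 0 < δ) (h1 : α < 1) :
    volume (square δ α) = ENNReal.ofReal (vol δ α) := by
  have hside : (vol δ α ^ (1 / 2 : ℝ)) ^ 2 = vol δ α := by
    rw [← Real.sqrt_eq_rpow, Real.sq_sqrt (vol_pos hδ h1).le]
  rw [square, Measure.addHaar_smul, volume_unitSquare, mul_one, finrank_euclideanSpace_fin, hside,
    abs_of_pos (vol_pos hδ h1)]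

theorem exists_forall_le_vol (h1 : α < 1) {v : ℝ} (hv : 0 < v) :
    ∃ δ₀, 0 < δ₀ ∧ ∀ δ, 0 < δ → δ < δ₀ → v ≤ vol δ α := by
  have := sub_pos.2 h1
  have hexp : 0 < 2 - α := by linarith
  have hc := c6_pos
  refine ⟨c6 / ((1 - α) * v ^ (2 - α)), by positivity, fun δ hδ hlt => ?_⟩
  have hle : v ^ (2 - α) ≤ c6 / (δ * (1 - α)) := by
    rw [lt_div_iff₀ (by positivity)] at hlt
    rw [le_div_iff₀ (by positivity)]
    linarith
  rwa [vol, one_div, Real.le_rpow_inv_iff_of_pos hv.le (by positivity) hexp]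

theorem exists_forall_ball_subset_square (h1 : α < 1) (ρ : ℝ) :
    ∃ δ₀, 0 < δ₀ ∧ ∀ δ, 0 < δ → δ < δ₀ → ∀ x ∈ square δ α,
      ∃ c, Metric.ball c ρ ⊆ square δ α ∧ ‖x - c‖ ^ 2 = 2 * ρ ^ 2 := by
  obtain ⟨δ₀, hδ₀, hvol⟩ := exists_forall_le_vol h1 (v := (4 * ρ) ^ 2 + 1) (by positivity)
  refine ⟨δ₀, hδ₀, fun δ hδ hlt x hx => exists_ball_subset_smul_unitSquare
    (Real.rpow_pos_of_pos (vol_pos hδ h1) _) ?_ hx⟩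
  rw [← Real.sqrt_eq_rpow]
  exact Real.le_sqrt_of_sq_le (by linarith [hvol δ hδ hlt])

namespace Admissible

variable {δ α : ℝ} {μ : Admissible δ α}

theorem nonempty_fin_N (μ : Admissible δ α) (hδ : 0 < δ) (h1 : α < 1) : Nonempty (Fin μ.N) := by
  by_contra hempty
  rw [not_nonempty_iff] at hempty
  exact (vol_pos hδ h1).ne (μ.sum_m ▸ Fintype.sum_empty μ.m).symm

section TransportMap

variable {A : Fin μ.N → Set Plane} {T : Plane → Plane}

theorem IsTransportMap.isPartition_cell (hT : μ.IsTransportMap T) :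
    IsPartition (square δ α) (μ.cell T) where
  measurableSet _ := (isCompact_square δ α).measurableSet.inter (hT.1 (measurableSet_singleton _))
  disjoint _ _ hij := Set.disjoint_left.2 fun _ hi hj => hij (μ.z_inj (hi.2.symm.trans hj.2))
  iUnion_eq := subset_antisymm (Set.iUnion_subset fun _ => Set.sep_subset _ _) fun x hx =>
    let ⟨i, hi⟩ := hT.2.1 x hx
    Set.mem_iUnion.2 ⟨i, hx, hi.symm⟩

theorem IsTransportMap.volume_cell (hT : μ.IsTransportMap T) (i : Fin μ.N) :
    volume.real (μ.cell T i) = μ.m i := by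
  rw [measureReal_def, hT.2.2 i, ENNReal.toReal_ofReal (μ.m_pos i).le]

theorem IsTransportMap.cost_eq (hT : μ.IsTransportMap T) :
    cost δ α T = ENNReal.ofReal (∑ i, moment volume (μ.cell T i) (μ.z i)) :=
  hT.isPartition_cell.lintegral_eq_sum_moment (isCompact_square δ α) μ.z fun _ _ hx => hx.2

theorem cell_eq_of_isPartition (hA : IsPartition (square δ α) A)
    (hT : ∀ i, ∀ x ∈ A i, T x = μ.z i) : μ.cell T = A := by
  ext i x
  refine ⟨fun ⟨hx, hTx⟩ => ?_, fun hx => ⟨hA.subset i hx, hT i x hx⟩⟩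
  obtain ⟨j, hj⟩ := hA.exists_mem hx
  rwa [← μ.z_inj ((hT j x hj).symm.trans hTx)]

theorem exists_isTransportMap_cell_eq (hδ : 0 < δ) (h1 : α < 1) (hA : IsPartition (square δ α) A)
    (hvol : ∀ i, volume.real (A i) = μ.m i) : ∃ T, μ.IsTransportMap T ∧ μ.cell T = A := by
  have := μ.nonempty_fin_N hδ h1
  obtain ⟨T, hTm, hT⟩ := hA.exists_measurable_map μ.z
  have hcell := cell_eq_of_isPartition hA hT
  refine ⟨T, ⟨hTm, fun x hx => ?_, fun i => ?_⟩, hcell⟩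
  · obtain ⟨j, hj⟩ := hA.exists_mem hx
    exact ⟨j, (hT j x hj).symm⟩
  · rw [hcell, ← hvol i,
      ofReal_measureReal (hA.measure_ne_top (isCompact_square δ α).measure_ne_top i)]

theorem W2sq_le_sum_moment (hδ : 0 < δ) (h1 : α < 1) (hA : IsPartition (square δ α) A)
    (hvol : ∀ i, volume.real (A i) = μ.m i) :
    μ.W2sq ≤ ENNReal.ofReal (∑ i, moment volume (A i) (μ.z i)) := by
  obtain ⟨T, hT, hcell⟩ := exists_isTransportMap_cell_eq hδ h1 hA hvol
  exact (iInf₂_le T hT).trans_eq (by rw [hT.cost_eq, hcell])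

theorem ofReal_partitionEnergy (h1 : α < 1) (hvol : ∀ i, volume.real (A i) = μ.m i) :
    ENNReal.ofReal (partitionEnergy volume (c6 / (1 - α)) α A μ.z) =
      ENNReal.ofReal (c6 / (1 - α) * ∑ i, μ.m i ^ α) +
        ENNReal.ofReal (∑ i, moment volume (A i) (μ.z i)) := by
  rw [partitionEnergy, ENNReal.ofReal_add
    (mul_nonneg (div_nonneg c6_pos.le (by linarith)) (Finset.sum_nonneg fun _ _ => by positivity))
    (Finset.sum_nonneg fun _ _ => moment_nonneg volume _ _)]
  simp only [hvol]

theorem energy_le_partitionEnergy (hδ : 0 < δ) (h1 : α < 1) (hA : IsPartition (square δ α) A)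
    (hvol : ∀ i, volume.real (A i) = μ.m i) :
    μ.energy ≤ ENNReal.ofReal (partitionEnergy volume (c6 / (1 - α)) α A μ.z) := by
  rw [energy, ofReal_partitionEnergy h1 hvol]
  gcongr
  exact W2sq_le_sum_moment hδ h1 hA hvol

theorem le_W2sq_of_subset_powerCell (hA : IsPartition (square δ α) A) {w : Fin μ.N → ℝ}
    (hAw : ∀ i, A i ⊆ powerCell (square δ α) μ.z w i) :
    ENNReal.ofReal (∑ i, moment volume (A i) (μ.z i) +
      ∑ i, w i * (μ.m i - volume.real (A i))) ≤ μ.W2sq := by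
  refine le_iInf₂ fun T hT => ?_
  rw [hT.cost_eq]
  refine ENNReal.ofReal_le_ofReal ?_
  have hle := (hT.isPartition_cell.sum_moment_sub_le_of_subset_powerCell (ν := volume) hA
    (isCompact_square δ α) hAw).1
  simp only [hT.volume_cell, Finset.sum_sub_distrib, mul_sub] at hle ⊢
  linarith

end TransportMap

section Competitors

variable {ι : Type} [Fintype ι] {A : ι → Set Plane} {p : ι → Plane}

theorem exists_energy_le_of_injective (hδ : 0 < δ) (h1 : α < 1) (hA : IsPartition (square δ α) A)
    (hpos : ∀ i, volume (A i) ≠ 0) (hp : ∀ i, p i ∈ square δ α) (hinj : Function.Injective p) :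
    ∃ ν : Admissible δ α,
      ν.energy ≤ ENNReal.ofReal (partitionEnergy volume (c6 / (1 - α)) α A p) := by
  have hQ : volume (square δ α) ≠ ⊤ := (isCompact_square δ α).measure_ne_top
  set e := (Fintype.equivFin ι).symm
  have hAe := hA.comp_equiv e
  let ν : Admissible δ α :=
    { N := Fintype.card ι
      m := fun k => volume.real (A (e k))
      z := p ∘ e
      m_pos := fun k => ENNReal.toReal_pos (hpos _) (hAe.measure_ne_top hQ k)
      sum_m := (hAe.sum_measureReal hQ).trans (by
        rw [measureReal_def, volume_square hδ h1, ENNReal.toReal_ofReal (vol_pos hδ h1).le])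
      z_mem := fun k => hp (e k)
      z_inj := hinj.comp e.injective }
  refine ⟨ν, (energy_le_partitionEnergy (μ := ν) hδ h1 hAe fun _ => rfl).trans_eq ?_⟩
  exact congrArg ENNReal.ofReal (congrArg₂ (c6 / (1 - α) * · + ·)
    (e.sum_comp fun i => volume.real (A i) ^ α) (e.sum_comp fun i => moment volume (A i) (p i)))

theorem exists_energy_le_of_isPartition (hδ : 0 < δ) (h0 : 0 < α) (h1 : α < 1)
    (hA : IsPartition (square δ α) A) (hp : ∀ i, p i ∈ square δ α) :
    ∃ ν : Admissible δ α,
      ν.energy ≤ ENNReal.ofReal (partitionEnergy volume (c6 / (1 - α)) α A p) := by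
  classical
  have hQ := isCompact_square δ α
  obtain ⟨i₀, hi₀⟩ := hA.exists_measure_ne_zero (ν := volume) (by
    rw [volume_square hδ h1]
    exact (ENNReal.ofReal_pos.2 (vol_pos hδ h1)).ne')
  -- Null cells are sent to `p i₀`, and cells with a common point are merged.
  set q : ι → Plane := fun i => if volume (A i) = 0 then p i₀ else p i with hq
  have hq₀ : q i₀ = p i₀ := if_neg hi₀
  have hmoment : ∀ i, moment volume (A i) (q i) = moment volume (A i) (p i) := fun i => by
    by_cases hi : volume (A i) = 0
    · rw [moment_of_measure_eq_zero hi, moment_of_measure_eq_zero hi]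
    · simp only [hq, if_neg hi]
  have hmerge := hA.fiberUnion (Set.rangeFactorization q)
  have hpos : ∀ k, volume (⋃ i ∈ {i | Set.rangeFactorization q i = k}, A i) ≠ 0 := by
    rintro ⟨_, i, rfl⟩ hnull
    have hcell : ∀ j, q j = q i → volume (A j) = 0 := fun j hj =>
      measure_mono_null (Set.subset_biUnion_of_mem (u := A) (Subtype.ext hj)) hnull
    refine hi₀ (hcell i₀ (hq₀.trans ?_))
    simp only [hq, if_pos (hcell i rfl)]
  have hq_mem : ∀ y : Set.range q, (y : Plane) ∈ square δ α := by
    rintro ⟨_, i, rfl⟩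
    simp only [hq]
    split_ifs <;> exact hp _
  obtain ⟨ν, hν⟩ := exists_energy_le_of_injective hδ h1 hmerge hpos hq_mem
    Subtype.val_injective
  refine ⟨ν, hν.trans (ENNReal.ofReal_le_ofReal ?_)⟩
  refine (hA.partitionEnergy_fiberUnion_le hQ (div_nonneg c6_pos.le (by linarith)) h0 h1.le
    _ _).trans_eq ?_
  exact congrArg (c6 / (1 - α) * ∑ i, volume.real (A i) ^ α + ·)
    (Finset.sum_congr rfl fun i _ => hmoment i)

end Competitors

/-- The weights given by the first variation of the energy in the masses of the atoms. -/
noncomputable def weight (μ : Admissible δ α) (i : Fin μ.N) : ℝ :=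
  -(c6 / (1 - α) * (α * μ.m i ^ (α - 1)))

/-- The Laguerre cells for the weights `weight`, with each tie given to the lowest index; for a
minimizer these are the cells of an optimal map. -/
noncomputable def optCell (μ : Admissible δ α) : Fin μ.N → Set Plane :=
  disjointed (μ.laguerreCell μ.weight)

theorem optCell_subset_powerCell (μ : Admissible δ α) (i : Fin μ.N) :
    μ.optCell i ⊆ powerCell (square δ α) μ.z μ.weight i :=
  disjointed_subset _ i

theorem isPartition_optCell (μ : Admissible δ α) (hδ : 0 < δ) (h1 : α < 1) :
    IsPartition (square δ α) μ.optCell :=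
  have := μ.nonempty_fin_N hδ h1
  isPartition_disjointed_powerCell (isCompact_square δ α).isClosed

namespace IsMinimizer

theorem energy_le (hμ : μ.IsMinimizer) (hδ : 0 < δ) (h0 : 0 < α) (h1 : α < 1) {ι : Type}
    [Fintype ι] {A : ι → Set Plane} {p : ι → Plane} (hA : IsPartition (square δ α) A)
    (hp : ∀ i, p i ∈ square δ α) :
    μ.energy ≤ ENNReal.ofReal (partitionEnergy volume (c6 / (1 - α)) α A p) :=
  let ⟨ν, hν⟩ := exists_energy_le_of_isPartition hδ h0 h1 hA hp
  (hμ ν).trans hν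

theorem volume_optCell (hμ : μ.IsMinimizer) (hδ : 0 < δ) (h0 : 0 < α) (h1 : α < 1) (i : Fin μ.N) :
    volume.real (μ.optCell i) = μ.m i := by
  have hK : 0 < c6 / (1 - α) := div_pos c6_pos (by linarith)
  have hC := μ.isPartition_optCell hδ h1
  have hle := (add_le_add_right (le_W2sq_of_subset_powerCell hC μ.optCell_subset_powerCell) _).trans
    (hμ.energy_le hδ h0 h1 hC μ.z_mem)
  have hreal : c6 / (1 - α) * ∑ i, μ.m i ^ α + (∑ i, moment volume (μ.optCell i) (μ.z i) +
      ∑ i, μ.weight i * (μ.m i - volume.real (μ.optCell i))) ≤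
      partitionEnergy volume (c6 / (1 - α)) α μ.optCell μ.z := by
    rw [← ENNReal.ofReal_le_ofReal_iff (partitionEnergy_nonneg hK.le _ _)]
    exact ENNReal.ofReal_add_le.trans hle
  have hweight : ∑ i, μ.weight i * (μ.m i - volume.real (μ.optCell i)) =
      c6 / (1 - α) * ∑ i, α * μ.m i ^ (α - 1) * (volume.real (μ.optCell i) - μ.m i) := by
    rw [Finset.mul_sum]
    refine Finset.sum_congr rfl fun j _ => ?_
    rw [weight]
    ring
  refine congrFun (eq_of_sum_tangent_le_sum_rpow μ.m_pos (fun _ => measureReal_nonneg) h0 h1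
    (le_of_mul_le_mul_left ?_ hK)) i
  rw [Finset.sum_add_distrib, mul_add]
  rw [partitionEnergy] at hreal
  linarith

theorem W2sq_eq (hμ : μ.IsMinimizer) (hδ : 0 < δ) (h0 : 0 < α) (h1 : α < 1) :
    μ.W2sq = ENNReal.ofReal (∑ i, moment volume (μ.optCell i) (μ.z i)) := by
  have hC := μ.isPartition_optCell hδ h1
  have hvol := hμ.volume_optCell hδ h0 h1
  refine (W2sq_le_sum_moment hδ h1 hC hvol).antisymm ?_
  simpa only [hvol, sub_self, mul_zero, Finset.sum_const_zero, add_zero] using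
    le_W2sq_of_subset_powerCell hC μ.optCell_subset_powerCell

theorem isOptimalPartition (hμ : μ.IsMinimizer) (hδ : 0 < δ) (h0 : 0 < α) (h1 : α < 1) :
    IsOptimalPartition volume (c6 / (1 - α)) α (square δ α) μ.optCell μ.z where
  isPartition := μ.isPartition_optCell hδ h1
  mem := μ.z_mem
  energy_le hB hp := by
    have hK : 0 ≤ c6 / (1 - α) := div_nonneg c6_pos.le (by linarith)
    rw [← ENNReal.ofReal_le_ofReal_iff (partitionEnergy_nonneg hK _ _),
      ofReal_partitionEnergy h1 (hμ.volume_optCell hδ h0 h1), ← hμ.W2sq_eq hδ h0 h1]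
    exact hμ.energy_le hδ h0 h1 hB hp

theorem volume_optCell_ne_zero (hμ : μ.IsMinimizer) (hδ : 0 < δ) (h0 : 0 < α) (h1 : α < 1)
    (i : Fin μ.N) : volume (μ.optCell i) ≠ 0 := fun hzero => by
  have hm := hμ.volume_optCell hδ h0 h1 i
  rw [measureReal_def, hzero, ENNReal.toReal_zero] at hm
  exact (μ.m_pos i).ne hm

theorem exists_isOptimalMap_cell_eq (hμ : μ.IsMinimizer) (hδ : 0 < δ) (h0 : 0 < α) (h1 : α < 1) :
    ∃ T, μ.IsOptimalMap T ∧ μ.cell T = μ.optCell := by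
  obtain ⟨T, hT, hcell⟩ := exists_isTransportMap_cell_eq hδ h1 (μ.isPartition_optCell hδ h1)
    (hμ.volume_optCell hδ h0 h1)
  exact ⟨T, ⟨hT, by rw [hT.cost_eq, hcell, hμ.W2sq_eq hδ h0 h1]⟩, hcell⟩

theorem ae_mem_cell_iff (hμ : μ.IsMinimizer) (hδ : 0 < δ) (h0 : 0 < α) (h1 : α < 1)
    {T : Plane → Plane} (hT : μ.IsOptimalMap T) :
    ∀ᵐ x, ∀ i, x ∈ μ.cell T i ↔ x ∈ powerCell (square δ α) μ.z μ.weight i := by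
  have hcell := hT.1.isPartition_cell
  have hcost : ∑ i, moment volume (μ.optCell i) (μ.z i) =
      ∑ i, moment volume (μ.cell T i) (μ.z i) := by
    rw [← ENNReal.ofReal_eq_ofReal_iff (Finset.sum_nonneg fun _ _ => moment_nonneg volume _ _)
      (Finset.sum_nonneg fun _ _ => moment_nonneg volume _ _), ← hT.1.cost_eq, hT.2,
      hμ.W2sq_eq hδ h0 h1]
  refine hcell.ae_mem_iff_mem_powerCell μ.z_inj
    ((hcell.sum_moment_sub_le_of_subset_powerCell (μ.isPartition_optCell hδ h1)
      (isCompact_square δ α) μ.optCell_subset_powerCell).2 ?_)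
  simp only [Finset.sum_sub_distrib, hcost, hT.1.volume_cell, hμ.volume_optCell hδ h0 h1]

theorem exists_isLaguerreMap (hμ : μ.IsMinimizer) (hδ : 0 < δ) (h0 : 0 < α) (h1 : α < 1)
    {T : Plane → Plane} (hT : μ.IsOptimalMap T) :
    ∃ T', T' =ᵐ[volume.restrict (square δ α)] T ∧ μ.IsLaguerreMap T' := by
  have hQ := isCompact_square δ α
  have hC := μ.isPartition_optCell hδ h1
  obtain ⟨T', hT', hcell⟩ := hμ.exists_isOptimalMap_cell_eq hδ h0 h1
  refine ⟨T', (ae_restrict_iff' hQ.measurableSet).2 ?_, hT', μ.weight, fun i => ?_⟩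
  · filter_upwards [hμ.ae_mem_cell_iff hδ h0 h1 hT, hμ.ae_mem_cell_iff hδ h0 h1 hT']
      with x hx hx' hxQ
    obtain ⟨i, hi⟩ := hT.1.isPartition_cell.exists_mem hxQ
    exact ((hx' i).2 ((hx i).1 hi)).2.trans hi.2.symm
  · rw [hcell]
    exact hC.closure_eq_powerCell hQ.isClosed (convex_square δ α) μ.z_inj
      μ.optCell_subset_powerCell (hμ.volume_optCell_ne_zero hδ h0 h1 i)

theorem cell_subset_powerCell (hμ : μ.IsMinimizer) (hδ : 0 < δ) (h0 : 0 < α) (h1 : α < 1)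
    {T : Plane → Plane} (hT : μ.IsLaguerreMap T) (i : Fin μ.N) :
    μ.cell T i ⊆ powerCell (square δ α) μ.z μ.weight i := by
  obtain ⟨hopt, w, hw⟩ := hT
  have hsub : ∀ j, μ.cell T j ⊆ powerCell (square δ α) μ.z w j := fun j =>
    subset_closure.trans (hw j).subset
  have hpos : volume (μ.cell T i) ≠ 0 := by
    rw [hopt.1.2.2 i]
    exact (ENNReal.ofReal_pos.2 (μ.m_pos i)).ne'
  refine (hsub i).trans ((subset_closure_of_convex_of_ae (ν := volume)
    (convex_powerCell (convex_square δ α) i) (fun h => hpos (measure_mono_null (hsub i) h))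
    ?_).trans (isClosed_powerCell (isCompact_square δ α).isClosed i).closure_subset)
  filter_upwards [hopt.1.isPartition_cell.ae_mem_iff_mem_powerCell μ.z_inj
    (ae_of_all volume fun x j hx => hsub j hx), hμ.ae_mem_cell_iff hδ h0 h1 hopt] with x hw hweight
  exact fun hx => (hweight i).1 ((hw i).2 hx)

end IsMinimizer

end Admissible

theorem volume_real_closedBall (c : Plane) {r : ℝ} (hr : 0 ≤ r) :
    volume.real (Metric.closedBall c r) = Real.pi * r ^ 2 := by
  rw [measureReal_def, EuclideanSpace.volume_closedBall_fin_two, ENNReal.toReal_mul,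
    ENNReal.toReal_pow, ENNReal.toReal_ofReal hr, ENNReal.toReal_ofReal Real.pi_pos.le, mul_comm]

namespace Admissible

theorem weight_nonpos {δ α : ℝ} (μ : Admissible δ α) (h0 : 0 < α) (h1 : α < 1) (i : Fin μ.N) :
    μ.weight i ≤ 0 :=
  neg_nonpos.2 (mul_nonneg (div_nonneg c6_pos.le (by linarith))
    (mul_nonneg h0.le (Real.rpow_nonneg (μ.m_pos i).le _)))

namespace IsMinimizer

variable {δ α r ρ : ℝ} {μ : Admissible δ α}

theorem exists_dist_lt (hμ : μ.IsMinimizer) (hδ : 0 < δ) (h0 : 0 < α) (h1 : α < 1) (hr : 0 ≤ r)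
    (hrρ : r < ρ) (hgain : c6 / (1 - α) * (Real.pi * r ^ 2) ^ α <
      (ρ ^ 2 - 2 * ρ * r) * (Real.pi * r ^ 2)) {c : Plane} (hc : Metric.ball c ρ ⊆ square δ α) :
    ∃ j, dist (μ.z j) c < ρ := by
  by_contra! hfar
  have hle := (hμ.isOptimalPartition hδ h0 h1).mul_measureReal_closedBall_le
    (isCompact_square δ α) (div_nonneg c6_pos.le (by linarith)) h0.le hr hrρ hc hfar
  rw [volume_real_closedBall c hr] at hle
  exact hle.not_gt hgain

theorem c6_le_dist_add_sq_mul_rpow (hμ : μ.IsMinimizer) (hδ : 0 < δ) (h0 : 0 < α) (h1 : α < 1)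
    {i j : Fin μ.N} {c : Plane} (hi : ρ ≤ dist (μ.z i) c) (hj : dist (μ.z j) c < ρ) :
    c6 ≤ (dist (μ.z i) c + ρ) ^ 2 * μ.m i ^ (1 - α) := by
  have hα : 0 < 1 - α := by linarith
  rw [← hμ.volume_optCell hδ h0 h1 i, ← div_mul_cancel₀ c6 hα.ne']
  exact (hμ.isOptimalPartition hδ h0 h1).mul_le_dist_add_sq_mul_rpow (isCompact_square δ α)
    (convex_square δ α) (div_nonneg c6_pos.le hα.le) h0 h1 (hμ.volume_optCell_ne_zero hδ h0 h1)
    hi hj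

theorem c6_le_of_le_infDist_frontier (hμ : μ.IsMinimizer) (hδ : 0 < δ) (h0 : 0 < α) (h1 : α < 1)
    (hρ : 0 < ρ) (hcover : ∀ c, Metric.ball c ρ ⊆ square δ α → ∃ j, dist (μ.z j) c < ρ)
    {i : Fin μ.N} (hi : 2 * ρ ≤ Metric.infDist (μ.z i) (frontier (square δ α))) :
    c6 ≤ (2 * ρ) ^ 2 * μ.m i ^ (1 - α) := by
  set c : Plane := μ.z i + EuclideanSpace.single 0 ρ
  have hdist : dist (μ.z i) c = ρ := by
    rw [dist_self_add_right, PiLp.norm_single, Real.norm_of_nonneg hρ.le]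
  have hc : Metric.ball c ρ ⊆ square δ α :=
    (Metric.ball_subset_ball' (by rw [dist_comm, hdist, two_mul])).trans
      (ball_subset_of_le_infDist_frontier (μ.z_mem i) hi)
  obtain ⟨j, hj⟩ := hcover c hc
  have hle := hμ.c6_le_dist_add_sq_mul_rpow hδ h0 h1 hdist.ge hj
  rwa [hdist, ← two_mul] at hle

theorem c6_le_of_norm_sub_sq_eq (hμ : μ.IsMinimizer) (hδ : 0 < δ) (h0 : 0 < α) (h1 : α < 1)
    (hcover : ∀ c, Metric.ball c ρ ⊆ square δ α → ∃ j, dist (μ.z j) c < ρ) {i : Fin μ.N}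
    {c : Plane} (hc : Metric.ball c ρ ⊆ square δ α) (hic : ‖μ.z i - c‖ ^ 2 = 2 * ρ ^ 2) :
    c6 ≤ 6 * ρ ^ 2 * μ.m i ^ (1 - α) := by
  obtain ⟨j, hj⟩ := hcover c hc
  rw [← dist_eq_norm] at hic
  have hρ : ρ ≤ dist (μ.z i) c := le_of_sq_le_sq (by linarith [sq_nonneg ρ]) dist_nonneg
  refine (hμ.c6_le_dist_add_sq_mul_rpow hδ h0 h1 hρ hj).trans ?_
  have hm := (μ.m_pos i).le
  gcongr
  linarith [add_sq_le (a := dist (μ.z i) c) (b := ρ)]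

theorem norm_sub_sq_le_of_mem_cell (hμ : μ.IsMinimizer) (hδ : 0 < δ) (h0 : 0 < α) (h1 : α < 1)
    (hcover : ∀ c, Metric.ball c ρ ⊆ square δ α → ∃ j, dist (μ.z j) c < ρ)
    (hcorner : ∀ x ∈ square δ α, ∃ c, Metric.ball c ρ ⊆ square δ α ∧ ‖x - c‖ ^ 2 = 2 * ρ ^ 2)
    {T : Plane → Plane} (hT : μ.IsLaguerreMap T) {i : Fin μ.N} {x : Plane}
    (hx : x ∈ μ.cell T i) : ‖x - μ.z i‖ ^ 2 ≤ 6 * ρ ^ 2 / (1 - α) := by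
  have hα : 0 < 1 - α := by linarith
  obtain ⟨c, hc, hxc⟩ := hcorner x hx.1
  obtain ⟨j, hj⟩ := hcover c hc
  have hxj : ‖x - μ.z j‖ ^ 2 ≤ 6 * ρ ^ 2 := by
    rw [← dist_eq_norm] at hxc ⊢
    calc dist x (μ.z j) ^ 2 ≤ (dist x c + ρ) ^ 2 := by
          gcongr
          linarith [dist_triangle_right x (μ.z j) c]
      _ ≤ 6 * ρ ^ 2 := by linarith [add_sq_le (a := dist x c) (b := ρ)]
  have hweight : -μ.weight j ≤ 6 * ρ ^ 2 * (α / (1 - α)) := by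
    obtain ⟨c', hc', hjc'⟩ := hcorner (μ.z j) (μ.z_mem j)
    have hmass := hμ.c6_le_of_norm_sub_sq_eq hδ h0 h1 hcover hc' hjc'
    calc -μ.weight j = c6 * (μ.m j ^ (1 - α))⁻¹ * (α / (1 - α)) := by
          rw [weight, ← neg_sub 1 α, Real.rpow_neg (μ.m_pos j).le]
          ring
      _ ≤ 6 * ρ ^ 2 * (α / (1 - α)) := by
          refine mul_le_mul_of_nonneg_right ?_ (div_nonneg h0.le hα.le)
          exact mul_inv_le_of_le_mul₀ (Real.rpow_nonneg (μ.m_pos j).le _) (by positivity) hmass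
  have hpower := (hμ.cell_subset_powerCell hδ h0 h1 hT i hx).2 j
  calc ‖x - μ.z i‖ ^ 2 ≤ 6 * ρ ^ 2 + 6 * ρ ^ 2 * (α / (1 - α)) := by
        linarith [μ.weight_nonpos h0 h1 i]
    _ = 6 * ρ ^ 2 / (1 - α) := by
        field_simp
        ring

theorem diam_cell_le (hμ : μ.IsMinimizer) (hδ : 0 < δ) (h0 : 0 < α) (h1 : α < 1)
    (hcover : ∀ c, Metric.ball c ρ ⊆ square δ α → ∃ j, dist (μ.z j) c < ρ)
    (hcorner : ∀ x ∈ square δ α, ∃ c, Metric.ball c ρ ⊆ square δ α ∧ ‖x - c‖ ^ 2 = 2 * ρ ^ 2)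
    {T : Plane → Plane} (hT : μ.IsLaguerreMap T) (i : Fin μ.N) :
    Metric.diam (μ.cell T i) ≤ 2 * √(6 * ρ ^ 2 / (1 - α)) := by
  have hball : μ.cell T i ⊆ Metric.closedBall (μ.z i) √(6 * ρ ^ 2 / (1 - α)) := fun x hx =>
    mem_closedBall_iff_norm.2
      (Real.le_sqrt_of_sq_le (hμ.norm_sub_sq_le_of_mem_cell hδ h0 h1 hcover hcorner hT hx))
  exact (Metric.diam_mono hball Metric.isBounded_closedBall).trans
    (Metric.diam_closedBall (Real.sqrt_nonneg _))

end IsMinimizer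

end Admissible

theorem rpow_div_lt_of_pow_lt_pow {x y : ℝ} {k n : ℕ} (hx : 0 ≤ x) (hy : 0 ≤ y) (hn : 0 < n)
    (h : x ^ k < y ^ n) : x ^ (k / n : ℝ) < y := by
  rw [div_eq_mul_inv, Real.rpow_mul hx, Real.rpow_natCast, Real.rpow_inv_lt_iff_of_pos
    (by positivity) hy (by positivity), Real.rpow_natCast]
  exact h

theorem alphaBar_pos : 0 < alphaBar := by norm_num [alphaBar]

theorem alphaBar_lt_one : alphaBar < 1 := by norm_num [alphaBar]

theorem lt_c6 : 0.1603 < c6 := by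
  have hsqrt : √3 < 1.7321 := by rw [Real.sqrt_lt' (by norm_num)]; norm_num
  rw [c6, lt_div_iff₀ (by positivity)]
  linarith

theorem c6_lt : c6 < 0.1604 := by
  have hsqrt : 1.732 < √3 := by rw [Real.lt_sqrt (by norm_num)]; norm_num
  rw [c6, div_lt_iff₀ (by positivity)]
  linarith

set_option exponentiation.threshold 1000 in
theorem insertion_gain : c6 / (1 - alphaBar) * (Real.pi * 0.266 ^ 2) ^ alphaBar <
    (1.17 ^ 2 - 2 * 1.17 * 0.266) * (Real.pi * 0.266 ^ 2) := by
  have hpi := Real.pi_gt_d4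
  have harea : Real.pi * 0.266 ^ 2 ≤ 0.2223 := by linarith [Real.pi_lt_d4]
  have hpow : (Real.pi * 0.266 ^ 2) ^ alphaBar < 0.4165 :=
    calc (Real.pi * 0.266 ^ 2) ^ alphaBar ≤ 0.2223 ^ alphaBar :=
          Real.rpow_le_rpow (by positivity) harea alphaBar_pos.le
      _ = 0.2223 ^ ((583 : ℕ) / (1000 : ℕ) : ℝ) := by norm_num [alphaBar]
      _ < 0.4165 := rpow_div_lt_of_pow_lt_pow (by norm_num) (by norm_num) (by norm_num)
          (by norm_num)
  have hcoeff : c6 / (1 - alphaBar) < 0.3847 := by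
    rw [div_lt_iff₀ (by linarith [alphaBar_lt_one])]
    exact c6_lt.trans_le (by norm_num [alphaBar])
  calc c6 / (1 - alphaBar) * (Real.pi * 0.266 ^ 2) ^ alphaBar ≤ 0.3847 * 0.4165 :=
        mul_le_mul hcoeff.le hpow.le (by positivity) (by norm_num)
    _ < (1.17 ^ 2 - 2 * 1.17 * 0.266) * (Real.pi * 0.266 ^ 2) := by linarith

theorem lt_of_c6_le_mul_rpow {m₀ m s y : ℝ} (hm₀ : 0 ≤ m₀) (hm : 0 ≤ m) (hs : 0 < s) (hy : 0 ≤ y)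
    (hpow : m₀ ^ 417 < y ^ 1000) (hsy : s * y ≤ 0.1603) (h : c6 ≤ s * m ^ (1 - alphaBar)) :
    m₀ < m := by
  refine (Real.rpow_lt_rpow_iff hm₀ hm (sub_pos.2 alphaBar_lt_one)).1
    (lt_of_mul_lt_mul_left ?_ hs.le)
  have hm₀y : m₀ ^ (1 - alphaBar) < y := by
    convert rpow_div_lt_of_pow_lt_pow hm₀ hy (by norm_num) hpow using 2
    norm_num [alphaBar]
  calc s * m₀ ^ (1 - alphaBar) ≤ s * y := mul_le_mul_of_nonneg_left hm₀y.le hs.le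
    _ < c6 := hsy.trans_lt lt_c6
    _ ≤ s * m ^ (1 - alphaBar) := h

set_option exponentiation.threshold 1000 in
theorem mBar_lt_of_c6_le {m : ℝ} (hm : 0 ≤ m)
    (h : c6 ≤ (2 * 1.17) ^ 2 * m ^ (1 - alphaBar)) : mBar < m :=
  lt_of_c6_le_mul_rpow (y := 0.0292) (by norm_num [mBar]) hm (by norm_num) (by norm_num)
    (by norm_num [mBar]) (by norm_num) h

set_option exponentiation.threshold 1000 in
theorem mB_lt_of_c6_le {m : ℝ} (hm : 0 ≤ m)
    (h : c6 ≤ 6 * 1.17 ^ 2 * m ^ (1 - alphaBar)) : mB < m :=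
  lt_of_c6_le_mul_rpow (y := 0.01) (by norm_num [mB]) hm (by norm_num) (by norm_num)
    (by norm_num [mB]) (by norm_num) h

theorem two_mul_sqrt_le_D0 : 2 * √(6 * 1.17 ^ 2 / (1 - alphaBar)) ≤ D0 := by
  have hR : 6 * 1.17 ^ 2 / (1 - alphaBar) ≤ 8 * R0 ^ 2 := by norm_num [alphaBar, R0]
  have hmass : 0 ≤ alphaBar / (1 - alphaBar) * c6 * mB ^ (alphaBar - 1) :=
    mul_nonneg (mul_nonneg (by norm_num [alphaBar]) c6_pos.le)
      (Real.rpow_nonneg (by norm_num [mB]) _)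
  rw [D0, ← Real.sqrt_eq_rpow]
  gcongr
  linarith

end Quantization

theorem lemma4p10_general {α r ρ : ℝ} (h0 : 0 < α) (h1 : α < 1) (hr : 0 ≤ r) (hrρ : r < ρ)
    (hgain : c6 / (1 - α) * (Real.pi * r ^ 2) ^ α < (ρ ^ 2 - 2 * ρ * r) * (Real.pi * r ^ 2)) :
    ∃ δ₀ : ℝ, 0 < δ₀ ∧ ∀ δ : ℝ, 0 < δ → δ < δ₀ → ∀ μ : Admissible δ α, μ.IsMinimizer →
      (∀ i, 2 * ρ ≤ Metric.infDist (μ.z i) (frontier (square δ α)) →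
        c6 ≤ (2 * ρ) ^ 2 * μ.m i ^ (1 - α)) ∧
      (∀ i, c6 ≤ 6 * ρ ^ 2 * μ.m i ^ (1 - α)) ∧
      (∀ (x : Plane) (R : ℝ), Metric.ball x R ⊆ square δ α →
        Metric.ball x R ∩ μ.supp = ∅ → R < ρ) ∧
      (∃ T, μ.IsOptimalMap T) ∧
      (∀ T, μ.IsOptimalMap T →
        ∃ T', T' =ᵐ[volume.restrict (square δ α)] T ∧ μ.IsLaguerreMap T') ∧
      (∀ T, μ.IsLaguerreMap T → ∀ i,
        Metric.diam (μ.cell T i) ≤ 2 * √(6 * ρ ^ 2 / (1 - α))) := by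
  obtain ⟨δ₀, hδ₀, hcorner⟩ := exists_forall_ball_subset_square h1 ρ
  refine ⟨δ₀, hδ₀, fun δ hδ hlt μ hμ => ?_⟩
  have hcover : ∀ c, Metric.ball c ρ ⊆ square δ α → ∃ j, dist (μ.z j) c < ρ := fun _ =>
    hμ.exists_dist_lt hδ h0 h1 hr hrρ hgain
  refine ⟨fun i => hμ.c6_le_of_le_infDist_frontier hδ h0 h1 (hr.trans_lt hrρ) hcover,
    fun i => ?_, fun x R hsub hempty => ?_, ?_, fun T => hμ.exists_isLaguerreMap hδ h0 h1,
    fun T => hμ.diam_cell_le hδ h0 h1 hcover (hcorner δ hδ hlt)⟩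
  · obtain ⟨c, hc, hic⟩ := hcorner δ hδ hlt (μ.z i) (μ.z_mem i)
    exact hμ.c6_le_of_norm_sub_sq_eq hδ h0 h1 hcover hc hic
  · by_contra! hR
    obtain ⟨j, hj⟩ := hcover x ((Metric.ball_subset_ball hR).trans hsub)
    exact (Set.disjoint_iff_inter_eq_empty.2 hempty).notMem_of_mem_left
      (Metric.ball_subset_ball hR hj) ⟨j, rfl⟩
  · obtain ⟨T, hT, -⟩ := hμ.exists_isOptimalMap_cell_eq hδ h0 h1
    exact ⟨T, hT⟩

theorem lemma4p10 :
    ∃ δ₀ : ℝ, 0 < δ₀ ∧ ∀ δ : ℝ, 0 < δ → δ < δ₀ →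
      ∀ μ : Admissible δ alphaBar, μ.IsMinimizer →
        -- masses of cells far from the boundary
        (∀ i, 4 ≤ Metric.infDist (μ.z i) (frontier (square δ alphaBar)) → mBar < μ.m i) ∧
        -- masses of cells close to the boundary
        (∀ i, Metric.infDist (μ.z i) (frontier (square δ alphaBar)) < 4 → mB < μ.m i) ∧
        -- particle-free balls
        (∀ (x : Plane) (R : ℝ), Metric.ball x R ⊆ square δ alphaBar →
          Metric.ball x R ∩ μ.supp = ∅ → R < R0) ∧
        -- the optimal map exists, can be normalized on a null set, and its cells have
        -- bounded diameter
        (∃ T, μ.IsOptimalMap T) ∧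
        (∀ T, μ.IsOptimalMap T →
          ∃ T', T' =ᵐ[volume.restrict (square δ alphaBar)] T ∧ μ.IsLaguerreMap T') ∧
        (∀ T, μ.IsLaguerreMap T → ∀ i, Metric.diam (μ.cell T i) ≤ D0) := by
  obtain ⟨δ₀, hδ₀, h⟩ := lemma4p10_general alphaBar_pos alphaBar_lt_one (by norm_num)
    (by norm_num) insertion_gain
  refine ⟨δ₀, hδ₀, fun δ hδ hlt μ hμ => ?_⟩
  obtain ⟨hinterior, hmass, hball, hexists, hnormalize, hdiam⟩ := h δ hδ hlt μ hμ
  exact ⟨fun i hi => mBar_lt_of_c6_le (μ.m_pos i).le (hinterior i (le_trans (by norm_num) hi)),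
    fun i _ => mB_lt_of_c6_le (μ.m_pos i).le (hmass i),
    fun x R hsub hempty => (hball x R hsub hempty).trans (by norm_num [R0]), hexists, hnormalize,
    fun T hT i => (hdiam T hT i).trans two_mul_sqrt_le_D0⟩
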